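/- **Setting.** Let $p\ge 3$, $1\le r\le p-2$, and $0=\tau_0<\tau_1<\dots<\tau_k<\tau_{k+1}=1$ (with $k\ge 0$). For a degree $q$ and regularity $s<q$, let $N^{s}_{q,i}$, $0\le i\le q+k(q-s)$, be the B-splines of degree $q$ on $[0,1]$ for the open knot vector in which $0$ and $1$ are repeated $q+1$ times and every $\tau_1,\dots,\tau_k$ is repeated $q-s$ times; let $\mathbb S^s_q$ be their span. Put $\mathbf I=\{0,\dots,p+k(p-r)\}$, $\mathbf I_0=\{0,\dots,p+k(p-r-1)\}$, $\mathbf I_1=\{0,\dots,p-1+k(p-r-1)\}$. Let $F^{(L)},F^{(R)}\in(\mathbb S^r_p\otimes\mathbb S^r_p)^2$ be two injective maps on $[0,1]^2$ with nowhere vanishing Jacobian determinant, with $F^{(L)}(0,t)=F^{(R)}(0,t)$ for $t\in[0,1]$ and $F^{(L)}([0,1]^2)\cap F^{(R)}([0,1]^2)=F^{(L)}(\{0\}\times[0,1])$, and let $\Omega=F^{(L)}([0,1]^2)\cup F^{(R)}([0,1]^2)\subset\mathbb R^2$. Assume that this two-patch geometry is analysis-suitable $G^1$: there are a function $\gamma:[0,1]\to\mathbb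 R\setminus\{0\}$ and polynomials $\alpha^{(S)},\beta^{(S)}$ of degree at most $1$, $S\in\{L,R\}$, with $\alpha^{(L)},\alpha^{(R)}$ relatively prime, such that on $[0,1]$ $$\alpha^{(S)}(t)=\gamma(t)\det\big(\partial_1F^{(S)}(0,t),\partial_2F^{(S)}(0,t)\big),\qquad \alpha^{(L)}\alpha^{(R)}<0,$$ $$\alpha^{(R)}(t)\,\partial_1F^{(L)}(0,t)-\alpha^{(L)}(t)\,\partial_1F^{(R)}(0,t)+\beta(t)\,\partial_2F^{(L)}(0,t)=0,\qquad \beta=\alpha^{(L)}\beta^{(R)}-\alpha^{(R)}\beta^{(L)},$$ where $\beta(t)=\gamma(t)\det\big(\partial_1F^{(L)}(0,t),\partial_1F^{(R)}(0,t)\big)$. Fix any such $\alpha^{(S)},\beta^{(S)}$. **One-level bases.** Let $\Phi$ be the set of the following functions on $\Omega$, given by their pull-backs for $S\in\{L,R\}$: * for $S'\in\{L,R\}$, $i\in\mathbf I\setminus\{0,1\}$, $j\in\mathbf I$: $\;\phi\circ F^{(S)}(\xi_1,\xi_2)=N^r_{p,i}(\xi_1)N^r_{p,j}(\xi_2)$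 if $S=S'$, and $0$ otherwise; * for $i\in\mathbf I_0$: $\;\phi\circ F^{(S)}(\xi_1,\xi_2)=N^{r+1}_{p,i}(\xi_2)\big(N^r_{p,0}(\xi_1)+N^r_{p,1}(\xi_1)\big)+\beta^{(S)}(\xi_2)\,(N^{r+1}_{p,i})'(\xi_2)\,\tfrac{\tau_1}{p}\,N^r_{p,1}(\xi_1)$; * for $i\in\mathbf I_1$: $\;\phi\circ F^{(S)}(\xi_1,\xi_2)=\alpha^{(S)}(\xi_2)\,N^r_{p-1,i}(\xi_2)\,N^r_{p,1}(\xi_1)$. For $\ell\ge 0$ let $\Phi^\ell$ be the set defined in the same way, with the same $F^{(S)},\alpha^{(S)},\beta^{(S)}$, from the breakpoints $\tau^\ell_0<\dots<\tau^\ell_{k^\ell+1}$ obtained from $\tau_0,\dots,\tau_{k+1}$ by $\ell$ dyadic refinements (each inserting the midpoints of all breakpoint intervals, so $k^{\ell}=2k^{\ell-1}+1$), with the same $p$ and $r$. **Hierarchy.** Let $N\ge1$, let $\Omega=\Omega^0\supseteq\Omega^1\supseteq\dots\supseteq\Omega^{N-1}$ be closed sets, and put $\Omega^N=\emptyset$.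 With $\operatorname{supp}^0\phi=\operatorname{supp}\phi\cap\Omega^0$, define $$\mathcal W=\bigcup_{\ell=0}^{N-1}\{\phi\in\Phi^\ell:\ \operatorname{supp}^0\phi\subseteq\Omega^\ell,\ \operatorname{supp}^0\phi\not\subseteq\Omega^{\ell+1}\},\qquad \mathbb W_H=\operatorname{span}\mathcal W .$$ **Theorem.** $\mathcal W$ is a basis of $\mathbb W_H$; that is, the functions in $\mathcal W$ are linearly independent. -/

import Mathlib

noncomputable section

namespace TwoPatch

open Set Polynomial

/-! ### Univariate B-splines on `[0,1]` -/

/-- `τ 0 = 0 < τ 1 < ⋯ < τ k < τ (k+1) = 1`: the numbers `τ 1, …, τ k` are the internal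
breakpoints, completed by the two end points of `[0,1]`. Values of `τ` beyond `k + 1` are never
used. -/
structure IsBreakpoints (k : ℕ) (τ : ℕ → ℝ) : Prop where
  zero : τ 0 = 0
  one : τ (k + 1) = 1
  lt_succ : ∀ i, i ≤ k → τ i < τ (i + 1)

/-- Position in the breakpoint sequence of the `i`-th knot (starting from `i = 0`) of the open knot
vector of degree `p` whose `k` internal breakpoints have multiplicity `m`. -/
def knotPos (p m k i : ℕ) : ℕ :=
  if i ≤ p then 0 else min ((i - (p + 1)) / m + 1) (k + 1)

/-- The open knot vector of degree `p` and regularity `r`: the end points `0` and `1` are repeated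
`p + 1` times, every internal breakpoint is repeated `p - r` times. -/
def knot (p r k : ℕ) (τ : ℕ → ℝ) (i : ℕ) : ℝ := τ (knotPos p (p - r) k i)

/-- B-splines for the knot sequence `t` by the Cox–de Boor recursion; fractions with denominator
zero count as zero. In degree zero the last nonempty knot span is closed at `1`, so that the
B-splines are continuous from the left at the end point `1`. -/
def bspline (t : ℕ → ℝ) : ℕ → ℕ → ℝ → ℝ
  | 0, i, x =>
    open Classical in
    if (t i ≤ x ∧ x < t (i + 1)) ∨ (x = 1 ∧ t i < 1 ∧ t (i + 1) = 1) then 1 else 0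
  | p + 1, i, x =>
    (x - t i) / (t (i + p + 1) - t i) * bspline t p i x +
      (t (i + p + 2) - x) / (t (i + p + 2) - t (i + 1)) * bspline t p (i + 1) x

/-- The `i`-th B-spline of the spline space of degree `p` and regularity `r` with internal
breakpoints `τ 1, …, τ k`, for `i < splineDim p r k`. -/
def splineN (p r k : ℕ) (τ : ℕ → ℝ) (i : ℕ) (x : ℝ) : ℝ := bspline (knot p r k τ) p i x

/-- The dimension `p + 1 + k (p - r)` of that spline space. -/
def splineDim (p r k : ℕ) : ℕ := p + 1 + k * (p - r)

theorem knot_eq_zero {p r k : ℕ} {τ : ℕ → ℝ} (hτ : IsBreakpoints k τ) {i : ℕ} (hi : i ≤ p) :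
    knot p r k τ i = 0 := by
  simp [knot, knotPos, hi, hτ.zero]

theorem IsBreakpoints.pos {k : ℕ} {τ : ℕ → ℝ} (hτ : IsBreakpoints k τ) :
    ∀ i, 1 ≤ i → i ≤ k + 1 → 0 < τ i := by
  intro i hi
  induction i, hi using Nat.le_induction with
  | base =>
    intro _
    have := hτ.lt_succ 0 (Nat.zero_le _)
    rwa [hτ.zero] at this
  | succ i _ ih =>
    intro h
    exact (ih (by omega)).trans (hτ.lt_succ i (by omega))

theorem knot_pos {p r k : ℕ} {τ : ℕ → ℝ} (hτ : IsBreakpoints k τ) {i : ℕ} (hi : p < i) :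
    0 < knot p r k τ i := by
  simp only [knot, knotPos, if_neg (not_le.mpr hi)]
  exact hτ.pos _ (by simp) (min_le_right _ _)

/-- Values of the B-splines at the left end point. -/
theorem bspline_knot_zero {p r k : ℕ} {τ : ℕ → ℝ} (hτ : IsBreakpoints k τ) :
    ∀ d i, d ≤ p → bspline (knot p r k τ) d i 0 = if i + d = p then 1 else 0 := by
  intro d
  induction d with
  | zero =>
    intro i _
    simp only [bspline, zero_ne_one, false_and, or_false, add_zero]
    congr 1
    apply propext
    constructor
    · rintro ⟨h1, h2⟩
      have h3 : i ≤ p := by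
        by_contra h
        exact absurd h1 (not_le.mpr (knot_pos hτ (not_le.mp h)))
      have h4 : ¬ i + 1 ≤ p := fun h => by
        rw [knot_eq_zero hτ h] at h2
        exact lt_irrefl _ h2
      omega
    · rintro rfl
      exact ⟨(knot_eq_zero hτ le_rfl).le, knot_pos hτ (Nat.lt_succ_self _)⟩
  | succ d ih =>
    intro i hd
    simp only [bspline]
    rw [ih i (by omega), ih (i + 1) (by omega)]
    have h1 : (0 - knot p r k τ i) / (knot p r k τ (i + d + 1) - knot p r k τ i) *
        (if i + d = p then (1 : ℝ) else 0) = 0 := by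
      split_ifs with h
      · rw [knot_eq_zero hτ (by omega)]
        simp
      · simp
    rw [h1, zero_add]
    by_cases h : i + (d + 1) = p
    · rw [if_pos h, if_pos (by omega), knot_eq_zero hτ (show i + 1 ≤ p by omega)]
      have : knot p r k τ (i + d + 2) ≠ 0 := (knot_pos hτ (by omega)).ne'
      simp [this]
    · rw [if_neg h, if_neg (by omega), mul_zero]

theorem splineN_zero {p r k : ℕ} {τ : ℕ → ℝ} (hτ : IsBreakpoints k τ) (i : ℕ) :
    splineN p r k τ i 0 = if i = 0 then 1 else 0 := by
  rw [splineN, bspline_knot_zero hτ p i le_rfl]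
  simp

/-! ### Two-patch geometries -/

/-- The two patches, left and right. -/
inductive Side
  | L
  | R

/-- The parameter square `[0,1]²`. -/
def unitSquare : Set (ℝ × ℝ) := Icc 0 1 ×ˢ Icc 0 1

/-- The tensor-product spline map `∑ᵢ ∑ⱼ N_i(ξ₁) N_j(ξ₂) c_{i,j}`. -/
def splineMap (p r k : ℕ) (τ : ℕ → ℝ) (c : ℕ → ℕ → ℝ × ℝ) (ξ : ℝ × ℝ) : ℝ × ℝ :=
  ∑ i ∈ Finset.range (splineDim p r k), ∑ j ∈ Finset.range (splineDim p r k),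
    (splineN p r k τ i ξ.1 * splineN p r k τ j ξ.2) • c i j

/-- First partial derivative on the unit square (one-sided at the boundary). -/
def partial₁ (F : ℝ × ℝ → ℝ × ℝ) (ξ : ℝ × ℝ) : ℝ × ℝ :=
  derivWithin (fun s => F (s, ξ.2)) (Icc 0 1) ξ.1

/-- Second partial derivative on the unit square (one-sided at the boundary). -/
def partial₂ (F : ℝ × ℝ → ℝ × ℝ) (ξ : ℝ × ℝ) : ℝ × ℝ :=
  derivWithin (fun s => F (ξ.1, s)) (Icc 0 1) ξ.2

/-- Determinant of the `2 × 2` matrix with columns `v`, `w`. -/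
def det₂ (v w : ℝ × ℝ) : ℝ := v.1 * w.2 - v.2 * w.1

/-- A planar two-patch geometry: two regular, injective tensor-product spline maps of degree `p` and
regularity `r` on `[0,1]²`, whose images meet exactly in the common interface, which is the edge
`ξ₁ = 0` of both patches with the same parameterization. -/
structure Geometry (p r k : ℕ) (τ : ℕ → ℝ) where
  /-- control points, used for indices below `splineDim p r k` -/
  ctrl : Side → ℕ → ℕ → ℝ × ℝ
  injOn : ∀ S, InjOn (splineMap p r k τ (ctrl S)) unitSquare
  regular : ∀ S, ∀ ξ ∈ unitSquare,
    det₂ (partial₁ (splineMap p r k τ (ctrl S)) ξ) (partial₂ (splineMap p r k τ (ctrl S)) ξ) ≠ 0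
  interface_eq : ∀ t ∈ Icc (0 : ℝ) 1,
    splineMap p r k τ (ctrl Side.L) (0, t) = splineMap p r k τ (ctrl Side.R) (0, t)
  inter_eq : splineMap p r k τ (ctrl Side.L) '' unitSquare ∩
      splineMap p r k τ (ctrl Side.R) '' unitSquare =
    (fun t : ℝ => splineMap p r k τ (ctrl Side.L) (0, t)) '' Icc 0 1

namespace Geometry

variable {p r k : ℕ} {τ : ℕ → ℝ} (G : Geometry p r k τ)

/-- The geometry mapping of patch `S`. -/
def map (S : Side) : ℝ × ℝ → ℝ × ℝ := splineMap p r k τ (G.ctrl S)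

/-- The patch `S`. -/
def patch (S : Side) : Set (ℝ × ℝ) := G.map S '' unitSquare

/-- The two-patch domain. -/
def domain : Set (ℝ × ℝ) := G.patch Side.L ∪ G.patch Side.R

theorem map_mem_domain (S : Side) {ξ : ℝ × ℝ} (hξ : ξ ∈ unitSquare) : G.map S ξ ∈ G.domain := by
  cases S
  · exact Or.inl ⟨ξ, hξ, rfl⟩
  · exact Or.inr ⟨ξ, hξ, rfl⟩

end Geometry

/-- Linear gluing functions for a two-patch geometry. A two-patch geometry is analysis-suitable
`G¹` if and only if such data exist. -/
structure GluingData {p r k : ℕ} {τ : ℕ → ℝ} (G : Geometry p r k τ) where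
  /-- the common factor, which is determined by the other data -/
  γ : ℝ → ℝ
  α : Side → ℝ[X]
  β : Side → ℝ[X]
  γ_ne_zero : ∀ t ∈ Icc (0 : ℝ) 1, γ t ≠ 0
  natDegree_α_le : ∀ S, (α S).natDegree ≤ 1
  natDegree_β_le : ∀ S, (β S).natDegree ≤ 1
  coprime : IsCoprime (α Side.L) (α Side.R)
  α_eq : ∀ S, ∀ t ∈ Icc (0 : ℝ) 1, (α S).eval t =
    γ t * det₂ (partial₁ (G.map S) (0, t)) (partial₂ (G.map S) (0, t))
  α_mul_neg : ∀ t ∈ Icc (0 : ℝ) 1, (α Side.L).eval t * (α Side.R).eval t < 0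
  β_eq : ∀ t ∈ Icc (0 : ℝ) 1,
    γ t * det₂ (partial₁ (G.map Side.L) (0, t)) (partial₁ (G.map Side.R) (0, t)) =
      (α Side.L).eval t * (β Side.R).eval t - (α Side.R).eval t * (β Side.L).eval t
  gluing : ∀ t ∈ Icc (0 : ℝ) 1,
    (α Side.R).eval t • partial₁ (G.map Side.L) (0, t) -
      (α Side.L).eval t • partial₁ (G.map Side.R) (0, t) +
      (γ t * det₂ (partial₁ (G.map Side.L) (0, t)) (partial₁ (G.map Side.R) (0, t))) •
        partial₂ (G.map Side.L) (0, t) = 0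

/-! ### The one-level `C¹` basis

The spline data `(k, τ)` of the geometry are kept apart from the spline data `(κ, σ)` of the level
on which the basis functions live. -/

/-- Pull-back to patch `S` of the standard basis function with index `(i, j)` of patch `S'`. -/
def pullStd (p r κ : ℕ) (σ : ℕ → ℝ) (S' : Side) (i j : ℕ) (S : Side) (ξ : ℝ × ℝ) : ℝ :=
  open Classical in
  if S = S' then splineN p r κ σ i ξ.1 * splineN p r κ σ j ξ.2 else 0

/-- Pull-back to patch `S` of the `i`-th interface function of the first kind. -/
def pullTrace (p r κ : ℕ) (σ : ℕ → ℝ) (β : Side → ℝ[X]) (i : ℕ) (S : Side) (ξ : ℝ × ℝ) : ℝ :=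
  splineN p (r + 1) κ σ i ξ.2 * (splineN p r κ σ 0 ξ.1 + splineN p r κ σ 1 ξ.1) +
    (β S).eval ξ.2 * derivWithin (splineN p (r + 1) κ σ i) (Icc 0 1) ξ.2 *
      (σ 1 / p) * splineN p r κ σ 1 ξ.1

/-- Pull-back to patch `S` of the `i`-th interface function of the second kind. -/
def pullDeriv (p r κ : ℕ) (σ : ℕ → ℝ) (α : Side → ℝ[X]) (i : ℕ) (S : Side) (ξ : ℝ × ℝ) : ℝ :=
  (α S).eval ξ.2 * splineN (p - 1) r κ σ i ξ.2 * splineN p r κ σ 1 ξ.1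

/-! The pull-backs agree on the common edge, so each of them comes from a function on the domain. -/

theorem pullStd_edge {p r κ : ℕ} {σ : ℕ → ℝ} (hσ : IsBreakpoints κ σ) (S' : Side) {i : ℕ}
    (hi : 2 ≤ i) (j : ℕ) (t : ℝ) :
    pullStd p r κ σ S' i j Side.L (0, t) = pullStd p r κ σ S' i j Side.R (0, t) := by
  have : i ≠ 0 := by omega
  simp [pullStd, splineN_zero hσ, this]

theorem pullTrace_edge {p r κ : ℕ} {σ : ℕ → ℝ} (hσ : IsBreakpoints κ σ) (β : Side → ℝ[X])
    (i : ℕ) (t : ℝ) :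
    pullTrace p r κ σ β i Side.L (0, t) = pullTrace p r κ σ β i Side.R (0, t) := by
  simp [pullTrace, splineN_zero hσ]

theorem pullDeriv_edge {p r κ : ℕ} {σ : ℕ → ℝ} (hσ : IsBreakpoints κ σ) (α : Side → ℝ[X])
    (i : ℕ) (t : ℝ) :
    pullDeriv p r κ σ α i Side.L (0, t) = pullDeriv p r κ σ α i Side.R (0, t) := by
  simp [pullDeriv, splineN_zero hσ]

namespace Geometry

variable {p r k : ℕ} {τ : ℕ → ℝ} (G : Geometry p r k τ)

open Classical in
/-- The function `φ` on the two-patch domain with `φ (F_S ξ) = f S ξ` for `ξ ∈ [0,1]²`, for functions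
`f L`, `f R` that agree on the edge `ξ₁ = 0`; see `glue_map`. -/
def glue (f : Side → ℝ × ℝ → ℝ) : G.domain → ℝ := fun x =>
  if (x : ℝ × ℝ) ∈ G.patch Side.L then
    f Side.L (Function.invFunOn (G.map Side.L) unitSquare x)
  else f Side.R (Function.invFunOn (G.map Side.R) unitSquare x)

theorem glue_map {f : Side → ℝ × ℝ → ℝ}
    (hf : ∀ t ∈ Icc (0 : ℝ) 1, f Side.L (0, t) = f Side.R (0, t))
    (S : Side) {ξ : ℝ × ℝ} (hξ : ξ ∈ unitSquare) :
    G.glue f ⟨G.map S ξ, G.map_mem_domain S hξ⟩ = f S ξ := by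
  have inv : ∀ (S : Side) {ξ : ℝ × ℝ}, ξ ∈ unitSquare →
      Function.invFunOn (G.map S) unitSquare (G.map S ξ) = ξ := fun S ξ hξ =>
    (G.injOn S).leftInvOn_invFunOn hξ
  cases S
  · simp only [glue]
    rw [if_pos ⟨ξ, hξ, rfl⟩, inv Side.L hξ]
  · simp only [glue]
    split_ifs with h
    · have h2 : G.map Side.R ξ ∈ G.patch Side.L ∩ G.patch Side.R := ⟨h, ξ, hξ, rfl⟩
      obtain ⟨t, ht, hte⟩ : G.map Side.R ξ ∈
          (fun t : ℝ => G.map Side.L (0, t)) '' Icc 0 1 := G.inter_eq ▸ h2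
      have hsq : ((0 : ℝ), t) ∈ unitSquare := ⟨⟨le_refl _, zero_le_one⟩, ht⟩
      have hR : ξ = (0, t) := by
        apply G.injOn Side.R hξ hsq
        have := G.interface_eq t ht
        exact hte.symm.trans this
      simp only at hte
      rw [← hte, inv Side.L hsq, hf t ht, hR]
    · rw [inv Side.R hξ]

variable {G} in
/-- The one-level set of standard basis functions of patch `S'`. -/
def ΦΩ (_g : GluingData G) (κ : ℕ) (σ : ℕ → ℝ) (S' : Side) : Set (G.domain → ℝ) :=
  {φ | ∃ i j, 2 ≤ i ∧ i < splineDim p r κ ∧ j < splineDim p r κ ∧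
    φ = G.glue (pullStd p r κ σ S' i j)}

variable {G} in
/-- The one-level set of interface functions of the first kind. -/
def ΦΓ₀ (g : GluingData G) (κ : ℕ) (σ : ℕ → ℝ) : Set (G.domain → ℝ) :=
  {φ | ∃ i, i < splineDim p (r + 1) κ ∧ φ = G.glue (pullTrace p r κ σ g.β i)}

variable {G} in
/-- The one-level set of interface functions of the second kind. -/
def ΦΓ₁ (g : GluingData G) (κ : ℕ) (σ : ℕ → ℝ) : Set (G.domain → ℝ) :=
  {φ | ∃ i, i < splineDim (p - 1) r κ ∧ φ = G.glue (pullDeriv p r κ σ g.α i)}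

variable {G} in
/-- The one-level `C¹` basis for the internal breakpoints `σ 1, …, σ κ`. -/
def Φ (g : GluingData G) (κ : ℕ) (σ : ℕ → ℝ) : Set (G.domain → ℝ) :=
  ΦΩ g κ σ Side.L ∪ ΦΩ g κ σ Side.R ∪ ΦΓ₀ g κ σ ∪ ΦΓ₁ g κ σ

end Geometry

/-! ### The hierarchical construction -/

/-- Number of internal breakpoints on level `ℓ` of dyadic refinement. -/
def levelCount (k : ℕ) : ℕ → ℕ
  | 0 => k
  | ℓ + 1 => 2 * levelCount k ℓ + 1

/-- Breakpoints on level `ℓ` of dyadic refinement: every step inserts the midpoints of all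
breakpoint intervals. -/
def levelBreak (τ : ℕ → ℝ) : ℕ → ℕ → ℝ
  | 0, j => τ j
  | ℓ + 1, j =>
    if Even j then levelBreak τ ℓ (j / 2)
    else (levelBreak τ ℓ (j / 2) + levelBreak τ ℓ (j / 2 + 1)) / 2

theorem IsBreakpoints.level {k : ℕ} {τ : ℕ → ℝ} (hτ : IsBreakpoints k τ) (ℓ : ℕ) :
    IsBreakpoints (levelCount k ℓ) (levelBreak τ ℓ) := by
  induction ℓ with
  | zero => exact ⟨hτ.zero, hτ.one, hτ.lt_succ⟩
  | succ ℓ ih =>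
    refine ⟨by simp [levelBreak, ih.zero], ?_, ?_⟩
    · have h1 : Even (levelCount k (ℓ + 1) + 1) := by
        simp only [levelCount]
        exact ⟨levelCount k ℓ + 1, by ring⟩
      have h2 : (levelCount k (ℓ + 1) + 1) / 2 = levelCount k ℓ + 1 := by
        simp only [levelCount]
        omega
      rw [levelBreak, if_pos h1, h2, ih.one]
    · intro i hi
      simp only [levelCount] at hi
      rcases Nat.even_or_odd' i with ⟨j, rfl | rfl⟩
      · have h1 : ¬ Even (2 * j + 1) := by simp
        have h2 : (2 * j + 1) / 2 = j := by omega
        have h3 : 2 * j / 2 = j := by omega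
        simp only [levelBreak, if_pos (even_two_mul j), if_neg h1, h2, h3]
        linarith [ih.lt_succ j (by omega)]
      · have h1 : ¬ Even (2 * j + 1) := by simp
        have h0 : Even (2 * j + 1 + 1) := ⟨j + 1, by ring⟩
        have h2 : (2 * j + 1) / 2 = j := by omega
        have h3 : (2 * j + 1 + 1) / 2 = j + 1 := by omega
        simp only [levelBreak, if_pos h0, if_neg h1, h2, h3]
        linarith [ih.lt_succ j (by omega)]

/-- A hierarchy `X = Ω^0 ⊇ Ω^1 ⊇ ⋯ ⊇ Ω^{N-1}` of closed sets, with the convention `Ω^ℓ = ∅` for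
`ℓ ≥ N`. -/
structure DomainHierarchy (X : Set (ℝ × ℝ)) (N : ℕ) where
  dom : ℕ → Set (ℝ × ℝ)
  dom_zero : dom 0 = X
  isClosed : ∀ ℓ, ℓ < N → IsClosed (dom ℓ)
  nested : ∀ ℓ, ℓ + 1 < N → dom (ℓ + 1) ⊆ dom ℓ
  dom_empty : ∀ ℓ, N ≤ ℓ → dom ℓ = ∅

/-- The support in the plane of a function on `X`: the closure of the set where it is nonzero. -/
def supp {X : Set (ℝ × ℝ)} (φ : X → ℝ) : Set (ℝ × ℝ) :=
  closure ((fun x : X => (x : ℝ × ℝ)) '' {x | φ x ≠ 0})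

namespace Geometry

variable {p r k : ℕ} {τ : ℕ → ℝ} {G : Geometry p r k τ}

/-- The one-level `C¹` basis of level `ℓ`. -/
def levelΦ (g : GluingData G) (ℓ : ℕ) : Set (G.domain → ℝ) :=
  Φ g (levelCount k ℓ) (levelBreak τ ℓ)

/-- The hierarchical set `𝒲`. -/
def hierSet (g : GluingData G) {N : ℕ} (D : DomainHierarchy G.domain N) : Set (G.domain → ℝ) :=
  {φ | ∃ ℓ < N, φ ∈ levelΦ g ℓ ∧
    supp φ ∩ D.dom 0 ⊆ D.dom ℓ ∧ ¬ (supp φ ∩ D.dom 0 ⊆ D.dom (ℓ + 1))}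

/-- The `C¹` hierarchical space `𝕎_H`, the span of `𝒲`. -/
def hierSpace (g : GluingData G) {N : ℕ} (D : DomainHierarchy G.domain N) :
    Submodule ℝ (G.domain → ℝ) :=
  Submodule.span ℝ (hierSet g D)

end Geometry

end TwoPatch

end

/-!
The proof follows Kraft's argument for hierarchical B-splines. Take a vanishing linear combination
of functions in `𝒲`, and let `ℓ` be the lowest level that still contributes. On the relatively open
set `Ω⁰ \ Ω^{ℓ+1}` all functions of higher levels vanish, while each function selected on level `ℓ`
is nonzero somewhere; so it suffices that the one-level basis is *locally* linearly independent:
a combination vanishing on a relatively open subset of the domain has only vanishing terms there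
(`linearIndependent_hierarchy`, `Geometry.locallyIndependent_Φ`).

Local independence is checked on a small rectangle, inside one mesh element, in the parameter square
of a patch (`pull_locally_independent`). In the direction transversal to the interface the basis
functions are combinations of the B-splines `N_i`, which are locally independent, so the
coefficients of `N₀`, of `N₁` and of each `N_i` with `i ≥ 2` vanish separately. Because of
`r + 2 ≤ p`, the splines `N₀` and `N₁` live only on the first mesh element, where both are active.
The coefficient of `N₀` is the combination of the traces of the functions of the first kind, so these
drop out, together with the derivatives occurring in the coefficient of `N₁`. What remains of the
latter is `α` times a combination of B-splines, and `α` has no zero on `[0,1]`. The coefficients of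
the other `N_i` are combinations of B-splines as well.

The local independence of univariate B-splines (`splineN_locally_independent`) comes from Marsden's
identity (`marsden`): the `d + 1` B-splines of degree `d` that are active on a knot span generate all
monomials of degree at most `d` there.
-/

namespace TwoPatch

open Set Polynomial Filter Topology

/-! ### Local linear independence of B-splines -/

/-- The point `x` lies in the knot span with index `μ`: the only B-spline of degree zero which is
nonzero at `x` is the one with index `μ`. -/
def InSpan (t : ℕ → ℝ) (μ : ℕ) (x : ℝ) : Prop :=
  ∀ i, bspline t 0 i x = if i = μ then 1 else 0

theorem bspline_eq_zero_of_inSpan {t : ℕ → ℝ} {μ : ℕ} {x : ℝ} (hx : InSpan t μ x) :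
    ∀ d i, ¬ (i ≤ μ ∧ μ ≤ i + d) → bspline t d i x = 0 := by
  intro d
  induction d with
  | zero =>
    intro i hi
    rw [hx, if_neg (by omega)]
  | succ d ih =>
    intro i hi
    rw [bspline, ih i (by omega), ih (i + 1) (by omega), mul_zero, mul_zero, add_zero]

/-- **Marsden's identity** on a single knot span. -/
theorem marsden {t : ℕ → ℝ} (ht : Monotone t) {μ : ℕ} (hμ : t μ < t (μ + 1)) {x : ℝ}
    (hx : InSpan t μ x) {n : ℕ} (hn : μ < n) :
    ∀ d, d ≤ μ → ∑ i ∈ Finset.range n, C (bspline t d i x) *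
      ∏ j ∈ Finset.range d, (X - C (t (i + 1 + j))) = (X - C x) ^ d := by
  intro d
  induction d with
  | zero =>
    intro _
    rw [Finset.sum_eq_single μ]
    · simp [hx μ]
    · intro i _ hi
      simp [hx i, hi]
    · intro h
      exact absurd (Finset.mem_range.mpr hn) h
  | succ d ih =>
    intro hd
    -- the contribution of the second summand of the recursion, before the shift of the index
    set h : ℕ → ℝ[X] := fun i =>
      C ((t (i + d + 1) - x) / (t (i + d + 1) - t i) * bspline t d i x) *
        ∏ j ∈ Finset.range (d + 1), (X - C (t (i + j))) with hh
    have h0 : h 0 = 0 := by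
      simp [hh, bspline_eq_zero_of_inSpan hx d 0 (by omega)]
    have hn0 : h n = 0 := by
      simp [hh, bspline_eq_zero_of_inSpan hx d n (by omega)]
    have hshift : ∑ i ∈ Finset.range n, h (i + 1) = ∑ i ∈ Finset.range n, h i := by
      have h1 := Finset.sum_range_succ' h n
      rw [Finset.sum_range_succ, h0, hn0, add_zero, add_zero] at h1
      exact h1.symm
    have hsplit : ∀ i, C (bspline t (d + 1) i x) *
          ∏ j ∈ Finset.range (d + 1), (X - C (t (i + 1 + j))) =
        C ((x - t i) / (t (i + d + 1) - t i) * bspline t d i x) *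
          ∏ j ∈ Finset.range (d + 1), (X - C (t (i + 1 + j))) + h (i + 1) := by
      intro i
      have e : i + 1 + d + 1 = i + d + 2 := by omega
      simp only [hh, e, bspline, C_add, add_mul]
    rw [Finset.sum_congr rfl fun i _ => hsplit i, Finset.sum_add_distrib, hshift,
      ← Finset.sum_add_distrib, pow_succ, ← ih (by omega), Finset.sum_mul]
    refine Finset.sum_congr rfl fun i _ => ?_
    by_cases hi : i ≤ μ ∧ μ ≤ i + d
    · have hne : t (i + d + 1) - t i ≠ 0 := by
        have h1 := ht hi.1
        have h2 : t (μ + 1) ≤ t (i + d + 1) := ht (by omega)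
        linarith
      have e1 : ∏ j ∈ Finset.range (d + 1), (X - C (t (i + 1 + j))) =
          (∏ j ∈ Finset.range d, (X - C (t (i + 1 + j)))) * (X - C (t (i + d + 1))) := by
        rw [Finset.prod_range_succ, show i + 1 + d = i + d + 1 by omega]
      have e2 : ∏ j ∈ Finset.range (d + 1), (X - C (t (i + j))) =
          (∏ j ∈ Finset.range d, (X - C (t (i + 1 + j)))) * (X - C (t i)) := by
        rw [Finset.prod_range_succ', add_zero]
        congr 1
        refine Finset.prod_congr rfl fun j _ => ?_
        rw [show i + (j + 1) = i + 1 + j by omega]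
      have hw : (t (i + d + 1) - x) / (t (i + d + 1) - t i) =
          1 - (x - t i) / (t (i + d + 1) - t i) := by
        field_simp
        ring
      have hx' : x = (x - t i) / (t (i + d + 1) - t i) * (t (i + d + 1) - t i) + t i := by
        field_simp
        ring
      simp only [hh]
      rw [e1, e2, hw]
      generalize (x - t i) / (t (i + d + 1) - t i) = w at hx'
      rw [show C x = C w * (C (t (i + d + 1)) - C (t i)) + C (t i) by
        rw [← C_sub, ← C_mul, ← C_add, ← hx']]
      simp only [C_mul, C_sub, C_1]
      ring
    · simp [hh, bspline_eq_zero_of_inSpan hx d i hi]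

theorem linearIndependent_pow_of_infinite {J : Set ℝ} (hJ : J.Infinite) (n : ℕ) :
    LinearIndependent ℝ (fun (s : Fin n) (y : J) => (y : ℝ) ^ (s : ℕ)) := by
  rw [Fintype.linearIndependent_iff]
  intro g hg s
  have hQ : (∑ s : Fin n, monomial (s : ℕ) (g s)) = 0 := by
    refine eq_zero_of_infinite_isRoot _ (hJ.mono fun y hy => ?_)
    have := congrFun hg ⟨y, hy⟩
    simpa [IsRoot, eval_finsetSum, eval_monomial] using this
  have := congrArg (fun Q => coeff Q (s : ℕ)) hQ
  simpa [finsetSum_coeff, coeff_monomial, Fin.val_inj] using this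

/-- The `d + 1` B-splines that are active on a knot span are linearly independent on each infinite
subset of it: by Marsden's identity they span the monomials of degree at most `d`. -/
theorem linearIndependent_bspline {t : ℕ → ℝ} (ht : Monotone t) {μ : ℕ} (hμ : t μ < t (μ + 1))
    {J : Set ℝ} (hJ : J.Infinite) (hspan : ∀ x ∈ J, InSpan t μ x) {d : ℕ} (hd : d ≤ μ) :
    LinearIndependent ℝ (fun (j : Fin (d + 1)) (y : J) => bspline t d (μ - d + j) y) := by
  set v := fun (j : Fin (d + 1)) (y : J) => bspline t d (μ - d + j) y with hv
  set u := fun (s : Fin (d + 1)) (y : J) => (y : ℝ) ^ (s : ℕ) with hu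
  have hli : LinearIndependent ℝ u := linearIndependent_pow_of_infinite hJ (d + 1)
  rw [linearIndependent_iff_card_le_finrank_span, ← finrank_span_eq_card hli]
  have := FiniteDimensional.span_of_finite ℝ (finite_range v)
  refine Submodule.finrank_mono (Submodule.span_le.mpr ?_)
  rintro _ ⟨s, rfl⟩
  have hs : (s : ℕ) ≤ d := Nat.lt_succ_iff.mp s.2
  -- compare the coefficients of order `d - s` in Marsden's identity
  have key : ((-1 : ℝ) ^ (s : ℕ) * (d.choose (d - s) : ℝ)) • u s =
      ∑ j : Fin (d + 1),
        (∏ l ∈ Finset.range d, (X - C (t (μ - d + j + 1 + l)))).coeff (d - s) • v j := by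
    funext y
    have hm := congrArg (fun Q => coeff Q (d - s))
      (marsden ht hμ (hspan y y.2) (Nat.lt_succ_self μ) d hd)
    simp only [finsetSum_coeff, coeff_C_mul, sub_eq_add_neg, ← C_neg,
      coeff_X_add_C_pow] at hm
    simp only [C_neg, ← sub_eq_add_neg] at hm
    rw [show d - (d - (s : ℕ)) = s by omega] at hm
    have hsum : ∑ i ∈ Finset.range (μ + 1), bspline t d i y *
        (∏ j ∈ Finset.range d, (X - C (t (i + 1 + j)))).coeff (d - s) =
        ∑ i ∈ Finset.Ico (μ - d) (μ + 1), bspline t d i y *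
        (∏ j ∈ Finset.range d, (X - C (t (i + 1 + j)))).coeff (d - s) := by
      symm
      refine Finset.sum_subset (fun i hi => ?_) (fun i _ hi => ?_)
      · simp only [Finset.mem_Ico, Finset.mem_range] at hi ⊢
        omega
      · rw [bspline_eq_zero_of_inSpan (hspan y y.2) d i
          (by simp only [Finset.mem_Ico] at hi; omega), zero_mul]
    rw [hsum, Finset.sum_Ico_eq_sum_range, show μ + 1 - (μ - d) = d + 1 by omega,
      Finset.sum_range] at hm
    simp only [Finset.sum_apply, Pi.smul_apply, smul_eq_mul, hu, hv]
    rw [← neg_one_mul, mul_pow] at hm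
    rw [show ∀ a b c : ℝ, a * b * c = a * c * b by intros; ring, ← hm]
    exact Finset.sum_congr rfl fun j _ => mul_comm _ _
  have hne : (-1 : ℝ) ^ (s : ℕ) * (d.choose (d - s) : ℝ) ≠ 0 :=
    mul_ne_zero (pow_ne_zero _ (by norm_num))
      (Nat.cast_ne_zero.mpr (Nat.choose_pos (Nat.sub_le _ _)).ne')
  have hmem : ((-1 : ℝ) ^ (s : ℕ) * (d.choose (d - s) : ℝ)) • u s ∈
      Submodule.span ℝ (range v) := by
    rw [key]
    exact Submodule.sum_mem _ fun j _ => Submodule.smul_mem _ _ (Submodule.subset_span ⟨j, rfl⟩)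
  exact (Submodule.smul_mem_iff _ hne).mp hmem

theorem coeff_eq_zero_of_sum_bspline_eq_zero {t : ℕ → ℝ} (ht : Monotone t) {μ : ℕ}
    (hμ : t μ < t (μ + 1)) {J : Set ℝ} (hJ : J.Infinite) (hspan : ∀ x ∈ J, InSpan t μ x)
    {d n : ℕ} (hd : d ≤ μ) (hn : μ < n) {a : ℕ → ℝ}
    (ha : ∀ x ∈ J, ∑ i ∈ Finset.range n, a i * bspline t d i x = 0)
    {i : ℕ} (hi : μ ≤ i + d) (hi' : i ≤ μ) : a i = 0 := by
  have hli := Fintype.linearIndependent_iff.mp (linearIndependent_bspline ht hμ hJ hspan hd)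
    (fun j => a (μ - d + j)) (by
      funext y
      have h := ha y y.2
      have hsum : ∑ i ∈ Finset.Ico (μ - d) (μ + 1), a i * bspline t d i y =
          ∑ i ∈ Finset.range n, a i * bspline t d i y := by
        refine Finset.sum_subset (fun i hi => ?_) (fun i _ hi => ?_)
        · simp only [Finset.mem_Ico, Finset.mem_range] at hi ⊢
          omega
        · rw [bspline_eq_zero_of_inSpan (hspan y y.2) d i
            (by simp only [Finset.mem_Ico] at hi; omega), mul_zero]
      rw [← hsum, Finset.sum_Ico_eq_sum_range, show μ + 1 - (μ - d) = d + 1 by omega,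
        Finset.sum_range] at h
      simpa using h)
    ⟨i - (μ - d), by omega⟩
  simpa [show μ - d + (i - (μ - d)) = i by omega] using hli

/-! ### Breakpoint intervals and one-sided neighbourhoods -/

theorem IsBreakpoints.le {k : ℕ} {τ : ℕ → ℝ} (hτ : IsBreakpoints k τ) {i j : ℕ} (hij : i ≤ j)
    (hj : j ≤ k + 1) : τ i ≤ τ j := by
  induction j, hij using Nat.le_induction with
  | base => exact le_rfl
  | succ j _ ih => exact (ih (by omega)).trans (hτ.lt_succ j (by omega)).le

theorem knotPos_mono (p m k : ℕ) : Monotone (knotPos p m k) := by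
  intro i j hij
  simp only [knotPos]
  have h : (i - (p + 1)) / m ≤ (j - (p + 1)) / m := Nat.div_le_div_right (by omega)
  split_ifs
  · exact le_rfl
  · exact Nat.zero_le _
  · omega
  · exact min_le_min_right _ (by omega)

theorem knotPos_le (p m k i : ℕ) : knotPos p m k i ≤ k + 1 := by
  simp only [knotPos]
  split_ifs
  · exact Nat.zero_le _
  · exact min_le_right _ _

theorem knot_mono {k : ℕ} {τ : ℕ → ℝ} (hτ : IsBreakpoints k τ) (p r : ℕ) :
    Monotone (knot p r k τ) := fun _ _ hij =>
  hτ.le (knotPos_mono _ _ _ hij) (knotPos_le _ _ _ _)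

/-- `p + m q` is the last index of a knot at the `m`-th breakpoint. -/
theorem knotPos_last {p q k m : ℕ} (hq : 1 ≤ q) (hm : m ≤ k) : knotPos p q k (p + m * q) = m := by
  simp only [knotPos]
  rcases m.eq_zero_or_pos with rfl | hm0
  · simp
  · obtain ⟨m, rfl⟩ : ∃ m', m = m' + 1 := ⟨m - 1, by omega⟩
    have h1 : 1 ≤ (m + 1) * q := Nat.mul_pos hm0 hq
    have h2 : (p + (m + 1) * q - (p + 1)) / q = m := by
      rw [show p + (m + 1) * q - (p + 1) = (q - 1) + m * q by rw [Nat.add_mul] at *; omega,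
        Nat.add_mul_div_right _ _ hq, Nat.div_eq_of_lt (by omega), zero_add]
    rw [if_neg (by omega), h2]
    omega

theorem knotPos_last_succ {p q k m : ℕ} (hq : 1 ≤ q) (hm : m ≤ k) :
    knotPos p q k (p + m * q + 1) = m + 1 := by
  simp only [knotPos]
  rw [if_neg (by omega), show p + m * q + 1 - (p + 1) = m * q by omega, Nat.mul_div_cancel _ hq]
  omega

/-- The `m`-th breakpoint interval, half-open except for the last one, which contains `1`. -/
def element (k : ℕ) (τ : ℕ → ℝ) (m : ℕ) : Set ℝ :=
  {x | τ m ≤ x ∧ (x < τ (m + 1) ∨ m = k ∧ x = 1)}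

theorem inSpan_of_mem_element {p r k : ℕ} {τ : ℕ → ℝ} (hτ : IsBreakpoints k τ) (hr : r < p)
    {m : ℕ} (hm : m ≤ k) {x : ℝ} (hx : x ∈ element k τ m) :
    InSpan (knot p r k τ) (p + m * (p - r)) x := by
  have hq : 1 ≤ p - r := by omega
  have hlt := hτ.lt_succ m hm
  have h1 : τ (m + 1) ≤ 1 := hτ.one ▸ hτ.le (Nat.succ_le_succ hm) le_rfl
  have e1 : knot p r k τ (p + m * (p - r)) = τ m := by rw [knot, knotPos_last hq hm]
  have e2 : knot p r k τ (p + m * (p - r) + 1) = τ (m + 1) := by rw [knot, knotPos_last_succ hq hm]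
  obtain ⟨hx1, hx2⟩ := hx
  intro i
  simp only [bspline]
  congr 1
  apply propext
  constructor
  · intro h
    by_contra hne
    rcases Nat.lt_or_gt_of_ne hne with hlt' | hgt
    · have h2 := knot_mono hτ p r (Nat.succ_le_of_lt hlt')
      rw [e1] at h2
      rcases h with h | h
      · exact absurd (h.2.trans_le (h2.trans hx1)) (lt_irrefl _)
      · linarith [h.2.2]
    · have h2 := knot_mono hτ p r (Nat.succ_le_of_lt hgt)
      rw [Nat.succ_eq_add_one, e2] at h2
      have h3 : knot p r k τ (i + 1) ≤ 1 := by
        rw [← hτ.one]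
        exact hτ.le (knotPos_le _ _ _ _) le_rfl
      rcases hx2 with hx2 | ⟨rfl, hx2⟩
      · rcases h with h | h <;> linarith only [h.1, h1, h2, hx2]
      · rw [hτ.one] at h2
        rcases h with h | h
        · linarith [h.2]
        · linarith [h.2.1]
  · rintro rfl
    rw [e1, e2]
    rcases hx2 with hx2 | ⟨rfl, hx2⟩
    · exact Or.inl ⟨hx1, hx2⟩
    · exact Or.inr ⟨hx2, hτ.one ▸ hlt, hτ.one⟩

/-- A B-spline not among those with indices `m (p - r), …, m (p - r) + p` vanishes on the `m`-th
breakpoint interval. -/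
theorem splineN_eq_zero {p r k : ℕ} {τ : ℕ → ℝ} (hτ : IsBreakpoints k τ) (hr : r < p)
    {m : ℕ} (hm : m ≤ k) {x : ℝ} (hx : x ∈ element k τ m) {i : ℕ}
    (hi : ¬ (m * (p - r) ≤ i ∧ i ≤ m * (p - r) + p)) : splineN p r k τ i x = 0 :=
  bspline_eq_zero_of_inSpan (inSpan_of_mem_element hτ hr hm hx) _ _ (by omega)

theorem splineN_coeff_eq_zero {p r k : ℕ} {τ : ℕ → ℝ} (hτ : IsBreakpoints k τ) (hr : r < p)
    {m : ℕ} (hm : m ≤ k) {J : Set ℝ} (hJ : J.Infinite) (hJm : J ⊆ element k τ m) {a : ℕ → ℝ}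
    (ha : ∀ x ∈ J, ∑ i ∈ Finset.range (splineDim p r k), a i * splineN p r k τ i x = 0)
    {i : ℕ} (hi : m * (p - r) ≤ i) (hi' : i ≤ m * (p - r) + p) : a i = 0 := by
  have hq : 1 ≤ p - r := by omega
  have hmk : m * (p - r) ≤ k * (p - r) := Nat.mul_le_mul_right _ hm
  refine coeff_eq_zero_of_sum_bspline_eq_zero (knot_mono hτ p r) (μ := p + m * (p - r)) ?_ hJ
    (fun x hx => inSpan_of_mem_element hτ hr hm (hJm hx)) (d := p) (n := splineDim p r k)
    (by omega) (by rw [splineDim]; omega) ha (by omega) (by omega)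
  rw [knot, knot, knotPos_last hq hm, knotPos_last_succ hq hm]
  exact hτ.lt_succ m hm

/-- **Local linear independence** of univariate B-splines. -/
theorem splineN_locally_independent {p r k : ℕ} {τ : ℕ → ℝ} (hτ : IsBreakpoints k τ) (hr : r < p)
    {m : ℕ} (hm : m ≤ k) {J : Set ℝ} (hJ : J.Infinite) (hJm : J ⊆ element k τ m) {a : ℕ → ℝ}
    (ha : ∀ x ∈ J, ∑ i ∈ Finset.range (splineDim p r k), a i * splineN p r k τ i x = 0)
    (i : ℕ) {x : ℝ} (hx : x ∈ J) : a i * splineN p r k τ i x = 0 := by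
  by_cases hi : m * (p - r) ≤ i ∧ i ≤ m * (p - r) + p
  · rw [splineN_coeff_eq_zero hτ hr hm hJ hJm ha hi.1 hi.2, zero_mul]
  · rw [splineN_eq_zero hτ hr hm (hJm hx) hi, mul_zero]

/-- The one-sided neighbourhoods of a point of `[0,1]` along which splines are continuous without
any smoothness at the breakpoints: from the right, except at the end point `1`. -/
noncomputable def side (x : ℝ) : Filter ℝ := if x < 1 then 𝓝[≥] x else 𝓝[≤] x

theorem side_le_nhds (x : ℝ) : side x ≤ 𝓝 x := by
  unfold side
  split_ifs <;> exact nhdsWithin_le_nhds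

theorem exists_Icc_subset_of_mem_side {x : ℝ} {J : Set ℝ} (hJ : J ∈ side x) :
    ∃ a b, a < b ∧ x ∈ Icc a b ∧ Icc a b ⊆ J := by
  unfold side at hJ
  split_ifs at hJ
  · obtain ⟨u, hu, h⟩ := mem_nhdsGE_iff_exists_Icc_subset.mp hJ
    exact ⟨x, u, hu, ⟨le_rfl, le_of_lt hu⟩, h⟩
  · obtain ⟨u, hu, h⟩ := mem_nhdsLE_iff_exists_Icc_subset.mp hJ
    exact ⟨u, x, hu, ⟨le_of_lt hu, le_rfl⟩, h⟩

theorem Icc_mem_side {x : ℝ} (hx : x ∈ Icc (0 : ℝ) 1) : Icc 0 1 ∈ side x := by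
  unfold side
  split_ifs with h
  · exact mem_of_superset (Icc_mem_nhdsGE h) (Icc_subset_Icc_left hx.1)
  · obtain rfl : x = 1 := le_antisymm hx.2 (not_lt.mp h)
    exact Icc_mem_nhdsLE zero_lt_one

theorem exists_element_mem_side {k : ℕ} {τ : ℕ → ℝ} (hτ : IsBreakpoints k τ) {x : ℝ}
    (hx : x ∈ Icc (0 : ℝ) 1) : ∃ m ≤ k, element k τ m ∈ side x := by
  unfold side
  split_ifs with h
  · have hex : ∃ n, x < τ n := ⟨k + 1, hτ.one ▸ h⟩
    classical
    have hn := Nat.find_spec hex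
    have hle : Nat.find hex ≤ k + 1 := Nat.find_min' hex (hτ.one ▸ h)
    have h0 : Nat.find hex ≠ 0 := fun h0 => by
      rw [h0, hτ.zero] at hn
      exact absurd hn (not_lt.mpr hx.1)
    obtain ⟨m, hm⟩ := Nat.exists_eq_succ_of_ne_zero h0
    have hmx : τ m ≤ x := not_lt.mp (Nat.find_min hex (by omega))
    rw [hm] at hn
    refine ⟨m, by omega, mem_of_superset (Ico_mem_nhdsGE hn) fun y hy => ?_⟩
    exact ⟨hmx.trans hy.1, Or.inl hy.2⟩
  · obtain rfl : x = 1 := le_antisymm hx.2 (not_lt.mp h)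
    have hlt := hτ.lt_succ k le_rfl
    rw [hτ.one] at hlt
    refine ⟨k, le_rfl, mem_of_superset (Icc_mem_nhdsLE hlt) fun y hy => ⟨hy.1, ?_⟩⟩
    rcases hy.2.lt_or_eq with h1 | h1
    · exact Or.inl (hτ.one ▸ h1)
    · exact Or.inr ⟨rfl, h1⟩

theorem mem_of_mem_side {x : ℝ} {J : Set ℝ} (hJ : J ∈ side x) : x ∈ J := by
  obtain ⟨a, b, _, hx, h⟩ := exists_Icc_subset_of_mem_side hJ
  exact h hx

theorem tendsto_splineN_side {p r k : ℕ} {τ : ℕ → ℝ} (hτ : IsBreakpoints k τ) (hr : r < p)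
    (i : ℕ) {x : ℝ} (hx : x ∈ Icc (0 : ℝ) 1) :
    Tendsto (splineN p r k τ i) (side x) (𝓝 (splineN p r k τ i x)) := by
  obtain ⟨m, hm, hmem⟩ := exists_element_mem_side hτ hx
  have key : ∀ d i, Tendsto (bspline (knot p r k τ) d i) (side x)
      (𝓝 (bspline (knot p r k τ) d i x)) := by
    intro d
    induction d with
    | zero =>
      intro i
      refine tendsto_const_nhds.congr' ?_
      filter_upwards [hmem] with y hy
      rw [inSpan_of_mem_element hτ hr hm (mem_of_mem_side hmem) i,
        inSpan_of_mem_element hτ hr hm hy i]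
    | succ d ih =>
      intro i
      have hid : Tendsto (fun y : ℝ => y) (side x) (𝓝 x) := side_le_nhds x
      exact (((hid.sub_const _).div_const _).mul (ih i)).add
        (((hid.const_sub _).div_const _).mul (ih (i + 1)))
  exact key p i

/-- A function vanishing on a nondegenerate subinterval has vanishing `derivWithin` there. At an
end point of the subinterval no differentiability is needed: without it, `derivWithin` is `0` by
convention. -/
theorem derivWithin_eq_zero_of_eqOn_zero {f : ℝ → ℝ} {s : Set ℝ} {a b : ℝ} (hab : a < b)
    (hs : Icc a b ⊆ s) (hf : ∀ x ∈ Icc a b, f x = 0) {x : ℝ} (hx : x ∈ Icc a b) :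
    derivWithin f s x = 0 := by
  by_cases hd : DifferentiableWithinAt ℝ f s x
  · have h1 : HasDerivWithinAt f (derivWithin f s x) (Icc a b) x := hd.hasDerivWithinAt.mono hs
    have h2 : HasDerivWithinAt f 0 (Icc a b) x :=
      (hasDerivWithinAt_const x (Icc a b) (0 : ℝ)).congr hf (hf x hx)
    exact (uniqueDiffOn_Icc hab x hx).eq_deriv _ h1 h2
  · exact derivWithin_zero_of_not_differentiableWithinAt hd

/-! ### Local linear independence of the `C¹` basis on one patch -/

/-- Local linear independence on a rectangle inside one mesh element. In the direction transversal
to the interface, the coefficients of `N₀`, `N₁` and of the other B-splines vanish separately. The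
coefficient of `N₀` involves only the interface functions of the first kind; once these are
eliminated, the coefficient of `N₁` is `α` times a combination of the splines of the second kind.
Since `r + 2 ≤ p`, both `N₀` and `N₁` live on the first mesh element only. -/
theorem pull_locally_independent {p r κ : ℕ} {σ : ℕ → ℝ} (hσ : IsBreakpoints κ σ)
    (hrp : r + 2 ≤ p) (α β : Side → ℝ[X]) (S : Side) {m₁ m₂ : ℕ} (hm₁ : m₁ ≤ κ) (hm₂ : m₂ ≤ κ)
    {J : Set ℝ} (hJ : J.Infinite) (hJm : J ⊆ element κ σ m₁)
    {a b : ℝ} (hab : a < b) (hm : Icc a b ⊆ element κ σ m₂) (h01 : Icc a b ⊆ Icc 0 1)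
    (hα : ∀ y ∈ Icc a b, (α S).eval y ≠ 0) {u : ℕ → ℕ → ℝ} {v w : ℕ → ℝ}
    (h : ∀ x ∈ J, ∀ y ∈ Icc a b,
      ∑ i ∈ Finset.range (splineDim p r κ - 2), ∑ j ∈ Finset.range (splineDim p r κ),
        u i j * (splineN p r κ σ (i + 2) x * splineN p r κ σ j y) +
      (∑ i ∈ Finset.range (splineDim p (r + 1) κ), v i * pullTrace p r κ σ β i S (x, y) +
        ∑ i ∈ Finset.range (splineDim (p - 1) r κ), w i * pullDeriv p r κ σ α i S (x, y)) = 0)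
    {x y : ℝ} (hx : x ∈ J) (hy : y ∈ Icc a b) :
    (∀ i j, u i j * (splineN p r κ σ (i + 2) x * splineN p r κ σ j y) = 0) ∧
      (∀ i, v i * pullTrace p r κ σ β i S (x, y) = 0) ∧
      ∀ i, w i * pullDeriv p r κ σ α i S (x, y) = 0 := by
  have hinf : (Icc a b).Infinite := Icc_infinite hab
  -- the coefficients of the combination with respect to the B-splines of the first variable
  let A : ℝ → ℕ → ℝ := fun y i => match i with
    | 0 => ∑ i ∈ Finset.range (splineDim p (r + 1) κ), v i * splineN p (r + 1) κ σ i y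
    | 1 => ∑ i ∈ Finset.range (splineDim p (r + 1) κ), v i * (splineN p (r + 1) κ σ i y +
          (β S).eval y * derivWithin (splineN p (r + 1) κ σ i) (Icc 0 1) y * (σ 1 / p)) +
        ∑ i ∈ Finset.range (splineDim (p - 1) r κ),
          w i * ((α S).eval y * splineN (p - 1) r κ σ i y)
    | i + 2 => ∑ j ∈ Finset.range (splineDim p r κ), u i j * splineN p r κ σ j y
  have hA : ∀ y ∈ Icc a b, ∀ i, m₁ * (p - r) ≤ i → i ≤ m₁ * (p - r) + p → A y i = 0 := by
    intro y hy i hi hi'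
    refine splineN_coeff_eq_zero hσ (by omega) hm₁ hJ hJm (fun x hx => ?_) hi hi'
    rw [← h x hx y hy,
      show splineDim p r κ = splineDim p r κ - 2 + 1 + 1 by rw [splineDim]; omega,
      Finset.sum_range_succ', Finset.sum_range_succ', add_assoc,
      show splineDim p r κ - 2 + 1 + 1 = splineDim p r κ by rw [splineDim]; omega]
    congr 1
    · refine Finset.sum_congr rfl fun i _ => ?_
      simp only [A, Finset.sum_mul]
      exact Finset.sum_congr rfl fun j _ => by ring
    · simp only [A, pullTrace, pullDeriv, add_mul, Finset.sum_mul, zero_add]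
      rw [add_right_comm, ← Finset.sum_add_distrib]
      congr 1
      · exact Finset.sum_congr rfl fun i _ => by ring
      · exact Finset.sum_congr rfl fun i _ => by ring
  have hstd : ∀ i j, u i j * (splineN p r κ σ (i + 2) x * splineN p r κ σ j y) = 0 := by
    intro i j
    by_cases hi : m₁ * (p - r) ≤ i + 2 ∧ i + 2 ≤ m₁ * (p - r) + p
    · have := splineN_locally_independent hσ (by omega) hm₂ hinf hm
        (fun y hy => hA y hy (i + 2) hi.1 hi.2) j hy
      rw [mul_left_comm, this, mul_zero]
    · rw [splineN_eq_zero hσ (by omega) hm₁ (hJm hx) hi, zero_mul, mul_zero]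
  refine ⟨hstd, ?_⟩
  rcases m₁.eq_zero_or_pos with rfl | hpos
  · have hT : ∀ i, ∀ y ∈ Icc a b, v i * splineN p (r + 1) κ σ i y = 0 := fun i y hy =>
      splineN_locally_independent hσ (by omega) hm₂ hinf hm
        (fun y hy => hA y hy 0 (by omega) (by omega)) i hy
    have hT' : ∀ i, ∀ y ∈ Icc a b,
        v i * derivWithin (splineN p (r + 1) κ σ i) (Icc 0 1) y = 0 := by
      intro i y hy
      by_cases hv : v i = 0
      · rw [hv, zero_mul]
      · rw [derivWithin_eq_zero_of_eqOn_zero hab h01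
          (fun z hz => (mul_eq_zero.mp (hT i z hz)).resolve_left hv) hy, mul_zero]
    have hD : ∀ y ∈ Icc a b, ∑ i ∈ Finset.range (splineDim (p - 1) r κ),
        w i * splineN (p - 1) r κ σ i y = 0 := by
      intro y hy
      have h1 := hA y hy 1 (by omega) (by omega)
      simp only [A] at h1
      rw [Finset.sum_eq_zero fun i _ => ?_, zero_add] at h1
      · refine (mul_eq_zero.mp ?_).resolve_left (hα y hy)
        rw [← h1, Finset.mul_sum]
        exact Finset.sum_congr rfl fun i _ => by ring
      · linear_combination hT i y hy + (β S).eval y * (σ 1 / p) * hT' i y hy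
    refine ⟨fun i => ?_, fun i => ?_⟩
    · simp only [pullTrace]
      linear_combination (splineN p r κ σ 0 x + splineN p r κ σ 1 x) * hT i y hy +
        (β S).eval y * (σ 1 / p) * splineN p r κ σ 1 x * hT' i y hy
    · have := splineN_locally_independent hσ (by omega) hm₂ hinf hm hD i hy
      simp only [pullDeriv]
      linear_combination (α S).eval y * splineN p r κ σ 1 x * this
  · have h2 : 2 ≤ m₁ * (p - r) := by nlinarith [show 2 ≤ p - r by omega]
    have hN0 : splineN p r κ σ 0 x = 0 :=
      splineN_eq_zero hσ (by omega) hm₁ (hJm hx) (by omega)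
    have hN1 : splineN p r κ σ 1 x = 0 :=
      splineN_eq_zero hσ (by omega) hm₁ (hJm hx) (by omega)
    simp [pullTrace, pullDeriv, hN0, hN1]

/-! ### Locally linearly independent sets of functions -/

/-- A set of functions on `X` is locally linearly independent if a linear combination of them
vanishes on a relatively open subset of `X` only when each of its terms does. -/
def LocallyIndependent {X : Set (ℝ × ℝ)} (Ψ : Set (X → ℝ)) : Prop :=
  ∀ O : Set (ℝ × ℝ), IsOpen O → ∀ s : Finset (X → ℝ), (s : Set (X → ℝ)) ⊆ Ψ →
    ∀ c : (X → ℝ) → ℝ, (∀ x : X, (x : ℝ × ℝ) ∈ O → ∑ φ ∈ s, c φ * φ x = 0) →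
      ∀ φ ∈ s, ∀ x : X, (x : ℝ × ℝ) ∈ O → c φ * φ x = 0

theorem LocallyIndependent.of_family {X : Set (ℝ × ℝ)} {ι : Type*} [Fintype ι] {f : ι → X → ℝ}
    (hf : ∀ O : Set (ℝ × ℝ), IsOpen O → ∀ c : ι → ℝ,
      (∀ x : X, (x : ℝ × ℝ) ∈ O → ∑ i, c i * f i x = 0) →
        ∀ i, ∀ x : X, (x : ℝ × ℝ) ∈ O → c i * f i x = 0) :
    LocallyIndependent (range f) := by
  classical
  intro O hO s hs c hc φ hφ x hx
  have : Nonempty ι := let ⟨i, _⟩ := hs hφ; ⟨i⟩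
  choose! e he using fun φ (hφ : φ ∈ s) => hs hφ
  have key : ∀ x : X, ∑ i, (if i ∈ s.image e then c (f i) else 0) * f i x =
      ∑ φ ∈ s, c φ * φ x := by
    intro x
    simp only [ite_mul, zero_mul, ← Finset.sum_filter, Finset.filter_univ_mem]
    rw [Finset.sum_image fun a ha b hb hab => by rw [← he a ha, ← he b hb, hab]]
    exact Finset.sum_congr rfl fun φ hφ => by rw [he φ hφ]
  have := hf O hO _ (fun x hx => (key x).trans (hc x hx)) (e φ) x hx
  rwa [if_pos (Finset.mem_image_of_mem e hφ), he φ hφ] at this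

/-- **Kraft's argument.** Functions selected level by level from locally independent sets are
linearly independent: outside of the next subdomain only one new level is active. -/
theorem linearIndependent_hierarchy {X : Set (ℝ × ℝ)} {N : ℕ} (D : DomainHierarchy X N)
    (Ψ : ℕ → Set (X → ℝ)) (hΨ : ∀ ℓ, LocallyIndependent (Ψ ℓ)) :
    LinearIndependent ℝ (Subtype.val : {φ : X → ℝ | ∃ ℓ < N, φ ∈ Ψ ℓ ∧
      supp φ ∩ D.dom 0 ⊆ D.dom ℓ ∧ ¬ (supp φ ∩ D.dom 0 ⊆ D.dom (ℓ + 1))} → X → ℝ) := by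
  classical
  rw [linearIndependent_subtype_iff, linearIndepOn_iff']
  intro s c hs hsum
  choose! lev hN hlev hsub hnot using fun φ (hφ : φ ∈ s) => hs hφ
  have hanti : ∀ i j, i ≤ j → j < N → D.dom j ⊆ D.dom i := by
    intro i j hij
    induction j, hij using Nat.le_induction with
    | base => exact fun _ => subset_rfl
    | succ j _ ih => exact fun hj => (D.nested j hj).trans (ih (by omega))
  have main : ∀ ℓ, ∀ φ ∈ s, lev φ = ℓ → c φ = 0 := by
    intro ℓ
    induction ℓ using Nat.strong_induction_on with
    | _ ℓ ih =>
      intro φ hφ hφℓ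
      have hopen : IsOpen (D.dom (ℓ + 1))ᶜ := by
        rw [isOpen_compl_iff]
        by_cases h : ℓ + 1 < N
        · exact D.isClosed _ h
        · rw [D.dom_empty _ (not_lt.mp h)]
          exact isClosed_empty
      have hloc := hΨ ℓ _ hopen (s.filter fun ψ => lev ψ = ℓ)
        (fun ψ hψ => by
          obtain ⟨h1, h2⟩ := Finset.mem_filter.mp hψ
          exact h2 ▸ hlev _ h1) c
        (fun x hx => by
          have h0 := congrFun hsum x
          simp only [Finset.sum_apply, Pi.smul_apply, smul_eq_mul, id, Pi.zero_apply] at h0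
          rw [← h0]
          refine Finset.sum_subset (Finset.filter_subset _ _) fun ψ hψ hψ' => ?_
          have hne : lev ψ ≠ ℓ := fun h => hψ' (Finset.mem_filter.mpr ⟨hψ, h⟩)
          rcases Nat.lt_or_gt_of_ne hne with hlt | hgt
          · rw [ih _ hlt ψ hψ rfl, zero_mul]
          · have hψx : ψ x = 0 := by
              by_contra hψx
              refine hx (hanti _ _ hgt (hN _ hψ) (hsub _ hψ ⟨subset_closure ⟨x, hψx, rfl⟩, ?_⟩))
              rw [D.dom_zero]
              exact x.2
            rw [hψx, mul_zero])
        φ (Finset.mem_filter.mpr ⟨hφ, hφℓ⟩)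
      have hnotφ := hnot _ hφ
      rw [hφℓ, not_subset] at hnotφ
      obtain ⟨z, ⟨hz, _⟩, hz'⟩ := hnotφ
      obtain ⟨_, hy, ⟨x, hx, rfl⟩⟩ := mem_closure_iff.mp hz _ hopen hz'
      exact (mul_eq_zero.mp (hloc x hy)).resolve_right hx
  exact fun φ hφ => main _ φ hφ rfl

/-! ### Local linear independence of the `C¹` basis -/

noncomputable instance : Fintype Side := by
  classical exact ⟨{Side.L, Side.R}, fun S => by cases S <;> simp⟩

theorem tendsto_splineMap_side {p r k : ℕ} {τ : ℕ → ℝ} (hτ : IsBreakpoints k τ) (hr : r < p)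
    (c : ℕ → ℕ → ℝ × ℝ) {ξ : ℝ × ℝ} (hξ : ξ ∈ unitSquare) :
    Tendsto (splineMap p r k τ c) (side ξ.1 ×ˢ side ξ.2) (𝓝 (splineMap p r k τ c ξ)) := by
  unfold splineMap
  refine tendsto_finsetSum _ fun i _ => tendsto_finsetSum _ fun j _ => ?_
  exact (((tendsto_splineN_side hτ hr i hξ.1).comp tendsto_fst).mul
    ((tendsto_splineN_side hτ hr j hξ.2).comp tendsto_snd)).smul_const _

namespace Geometry

variable {p r k : ℕ} {τ : ℕ → ℝ} {G : Geometry p r k τ}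

/-- Indices of the one-level basis: standard functions of each patch, with the index of the first
variable shifted by `2`, and interface functions of the first and of the second kind. -/
abbrev Index (p r κ : ℕ) : Type :=
  (Side × Fin (splineDim p r κ - 2) × Fin (splineDim p r κ)) ⊕
    (Fin (splineDim p (r + 1) κ) ⊕ Fin (splineDim (p - 1) r κ))

/-- The pull-backs of the one-level basis functions. -/
noncomputable def pullBasis (g : GluingData G) (κ : ℕ) (σ : ℕ → ℝ) : Index p r κ → Side → ℝ × ℝ → ℝ
  | Sum.inl (S', i, j) => pullStd p r κ σ S' (i + 2) j
  | Sum.inr (Sum.inl i) => pullTrace p r κ σ g.β i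
  | Sum.inr (Sum.inr i) => pullDeriv p r κ σ g.α i

theorem Φ_subset_range_glue_pullBasis (g : GluingData G) (κ : ℕ) (σ : ℕ → ℝ) :
    Φ g κ σ ⊆ range fun i => G.glue (pullBasis g κ σ i) := by
  have hstd : ∀ S', ΦΩ g κ σ S' ⊆ range fun i => G.glue (pullBasis g κ σ i) := by
    rintro S' _ ⟨i, j, hi, hi', hj, rfl⟩
    refine ⟨Sum.inl (S', ⟨i - 2, by omega⟩, ⟨j, hj⟩), ?_⟩
    simp only [pullBasis]
    rw [show i - 2 + 2 = i by omega]
  rintro _ (((h | h) | ⟨i, hi, rfl⟩) | ⟨i, hi, rfl⟩)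
  · exact hstd _ h
  · exact hstd _ h
  · exact ⟨Sum.inr (Sum.inl ⟨i, hi⟩), rfl⟩
  · exact ⟨Sum.inr (Sum.inr ⟨i, hi⟩), rfl⟩

theorem glue_pullBasis_map (g : GluingData G) {κ : ℕ} {σ : ℕ → ℝ} (hσ : IsBreakpoints κ σ)
    (i : Index p r κ) (S : Side) {ξ : ℝ × ℝ} (hξ : ξ ∈ unitSquare) :
    G.glue (pullBasis g κ σ i) ⟨G.map S ξ, G.map_mem_domain S hξ⟩ = pullBasis g κ σ i S ξ := by
  refine G.glue_map (fun t _ => ?_) S hξ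
  rcases i with ⟨S', i, j⟩ | i | i
  · exact pullStd_edge hσ S' (by omega) _ t
  · exact pullTrace_edge hσ g.β _ t
  · exact pullDeriv_edge hσ g.α _ t

theorem exists_map_eq (x : G.domain) :
    ∃ S, ∃ ξ, ∃ hξ : ξ ∈ unitSquare, x = ⟨G.map S ξ, G.map_mem_domain S hξ⟩ := by
  obtain ⟨_, ⟨ξ, hξ, rfl⟩ | ⟨ξ, hξ, rfl⟩⟩ := x
  · exact ⟨Side.L, ξ, hξ, rfl⟩
  · exact ⟨Side.R, ξ, hξ, rfl⟩

theorem α_eval_ne_zero (g : GluingData G) (S : Side) {t : ℝ} (ht : t ∈ Icc (0 : ℝ) 1) :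
    (g.α S).eval t ≠ 0 := by
  have h := (g.α_mul_neg t ht).ne
  cases S
  · exact left_ne_zero_of_mul h
  · exact right_ne_zero_of_mul h

theorem sum_pullBasis (g : GluingData G) (κ : ℕ) (σ : ℕ → ℝ) (c : Index p r κ → ℝ) (S : Side)
    (ξ : ℝ × ℝ) : ∑ i, c i * pullBasis g κ σ i S ξ =
      ∑ i : Fin (splineDim p r κ - 2), ∑ j : Fin (splineDim p r κ), c (Sum.inl (S, i, j)) *
        (splineN p r κ σ (i + 2) ξ.1 * splineN p r κ σ j ξ.2) +
      (∑ i : Fin (splineDim p (r + 1) κ), c (Sum.inr (Sum.inl i)) * pullTrace p r κ σ g.β i S ξ +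
        ∑ i : Fin (splineDim (p - 1) r κ),
          c (Sum.inr (Sum.inr i)) * pullDeriv p r κ σ g.α i S ξ) := by
  rw [Fintype.sum_sum_type, Fintype.sum_sum_type, Fintype.sum_prod_type,
    Fintype.sum_eq_single S fun S' hS' => ?_]
  · rw [Fintype.sum_prod_type]
    simp [pullBasis, pullStd]
  · exact Finset.sum_eq_zero fun ij _ => by simp [pullBasis, pullStd, hS'.symm]

theorem locallyIndependent_Φ (hτ : IsBreakpoints k τ) (hrp : r + 2 ≤ p) (g : GluingData G)
    {κ : ℕ} {σ : ℕ → ℝ} (hσ : IsBreakpoints κ σ) : LocallyIndependent (Φ g κ σ) := by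
  suffices h : LocallyIndependent (range fun i => G.glue (pullBasis g κ σ i)) from
    fun O hO s hs => h O hO s (hs.trans (Φ_subset_range_glue_pullBasis g κ σ))
  refine LocallyIndependent.of_family fun O hO c hc => ?_
  intro i x hx
  obtain ⟨S, ξ, hξ, rfl⟩ := exists_map_eq x
  simp only [glue_pullBasis_map g hσ i S hξ]
  -- a rectangle containing `ξ`, inside one mesh element and inside the preimage of `O`
  obtain ⟨m₁, hm₁, hmem₁⟩ := exists_element_mem_side hσ hξ.1
  obtain ⟨m₂, hm₂, hmem₂⟩ := exists_element_mem_side hσ hξ.2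
  have hpre : G.map S ⁻¹' O ∈ side ξ.1 ×ˢ side ξ.2 :=
    tendsto_splineMap_side hτ (by omega) (G.ctrl S) hξ (hO.mem_nhds hx)
  obtain ⟨V₁, hV₁, V₂, hV₂, hV⟩ := Filter.mem_prod_iff.mp hpre
  obtain ⟨a₁, b₁, hab₁, hξ₁, hJ₁⟩ := exists_Icc_subset_of_mem_side
    (inter_mem (inter_mem hmem₁ hV₁) (Icc_mem_side hξ.1))
  obtain ⟨a₂, b₂, hab₂, hξ₂, hJ₂⟩ := exists_Icc_subset_of_mem_side
    (inter_mem (inter_mem hmem₂ hV₂) (Icc_mem_side hξ.2))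
  -- the coefficients, extended by zero to all natural numbers
  let u : ℕ → ℕ → ℝ := fun i j =>
    if h : i < splineDim p r κ - 2 ∧ j < splineDim p r κ then
      c (Sum.inl (S, ⟨i, h.1⟩, ⟨j, h.2⟩)) else 0
  let v : ℕ → ℝ := fun i =>
    if h : i < splineDim p (r + 1) κ then c (Sum.inr (Sum.inl ⟨i, h⟩)) else 0
  let w : ℕ → ℝ := fun i =>
    if h : i < splineDim (p - 1) r κ then c (Sum.inr (Sum.inr ⟨i, h⟩)) else 0
  have hu : ∀ (i : Fin (splineDim p r κ - 2)) (j : Fin (splineDim p r κ)),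
      u i j = c (Sum.inl (S, i, j)) := fun i j => dif_pos ⟨i.2, j.2⟩
  have hv : ∀ i : Fin (splineDim p (r + 1) κ), v i = c (Sum.inr (Sum.inl i)) :=
    fun i => dif_pos i.2
  have hw : ∀ i : Fin (splineDim (p - 1) r κ), w i = c (Sum.inr (Sum.inr i)) :=
    fun i => dif_pos i.2
  have key := pull_locally_independent hσ hrp g.α g.β S hm₁ hm₂ (Icc_infinite hab₁)
    (fun x hx => (hJ₁ hx).1.1) hab₂ (fun y hy => (hJ₂ hy).1.1) (fun y hy => (hJ₂ hy).2)
    (fun y hy => α_eval_ne_zero g S (hJ₂ hy).2) (u := u) (v := v) (w := w)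
    (fun x hx y hy => by
      have hxy : (x, y) ∈ unitSquare := ⟨(hJ₁ hx).2, (hJ₂ hy).2⟩
      have h := hc ⟨G.map S (x, y), G.map_mem_domain S hxy⟩
        (hV ⟨(hJ₁ hx).1.2, (hJ₂ hy).1.2⟩)
      simp only [glue_pullBasis_map g hσ _ S hxy] at h
      rw [sum_pullBasis] at h
      rw [← h]
      simp only [Finset.sum_range, hu, hv, hw]) hξ₁ hξ₂
  rcases i with ⟨S', i, j⟩ | i | i
  · by_cases hS : S = S'
    · subst hS
      have := key.1 i j
      simpa [hu, pullBasis, pullStd] using this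
    · simp [pullBasis, pullStd, hS]
  · exact hv i ▸ key.2.1 i
  · exact hw i ▸ key.2.2 i

end Geometry

end TwoPatch

theorem mainTheorem1 (p r k : ℕ) (hp : 3 ≤ p) (hr : 1 ≤ r) (hrp : r + 2 ≤ p)
    (τ : ℕ → ℝ) (hτ : TwoPatch.IsBreakpoints k τ)
    (G : TwoPatch.Geometry p r k τ) (g : TwoPatch.GluingData G)
    (N : ℕ) (D : TwoPatch.DomainHierarchy G.domain N) :
    ∃ b : Module.Basis (TwoPatch.Geometry.hierSet g D) ℝ (TwoPatch.Geometry.hierSpace g D),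
      ∀ φ : TwoPatch.Geometry.hierSet g D, (b φ : G.domain → ℝ) = φ := by
  have hli : LinearIndependent ℝ
      (Subtype.val : TwoPatch.Geometry.hierSet g D → G.domain → ℝ) :=
    TwoPatch.linearIndependent_hierarchy D (TwoPatch.Geometry.levelΦ g) fun ℓ =>
      TwoPatch.Geometry.locallyIndependent_Φ hτ hrp g (hτ.level ℓ)
  have hspan : Submodule.span ℝ (Set.range
      (Subtype.val : TwoPatch.Geometry.hierSet g D → G.domain → ℝ)) =
      TwoPatch.Geometry.hierSpace g D := by
    rw [Subtype.range_coe, TwoPatch.Geometry.hierSpace]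
  exact ⟨(Module.Basis.span hli).map (LinearEquiv.ofEq _ _ hspan), fun φ => by simp⟩
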